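/- Let $q(x)=\delta x^2+\beta x+\gamma$ with $\delta,\beta,\gamma\in\mathbb R$ not all zero. A real random variable $X$ is said to satisfy $X\sim \mathrm{IP}(\mu;q)$ if it has a finite mean $\mu=\mathbb E X$ and a Lebesgue density $f$ such that $$\int_{-\infty}^x(\mu-t)f(t)\,dt=q(x)f(x)\qquad\text{for all }x\in\mathbb R .$$ Let $X\sim \mathrm{IP}(\mu;q)$ and let $n\ge 1$ be an integer. Then $\mathbb E|X|^{2n}<\infty$ if and only if $\delta<\frac1{2n-1}$. Assume that this holds. Then the orthonormal polynomials $\phi_0,\dots,\phi_n$ of $X$ exist: $\deg\phi_k=k$, the leading coefficient of $\phi_k$ is positive, and $\mathbb E[\phi_i(X)\phi_j(X)]=\delta_{ij}$ (Kronecker's delta). Let $m\in\{0,1,\dots,n\}$. Then $$0<\mathbb E\,q^m(X)=A_m(\mu;q):=\frac{\prod_{j=0}^{m-1}(1-2j\delta)}{\prod_{j=0}^{m-1}(1-(2j+1)\delta)}\prod_{j=0}^{m-1}q\!\left(\frac{\mu+j\beta}{1-2j\delta}\right)<\infty ,$$ the function $f_m=q^m f/\mathbb E\,q^m(X)$ is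 (almost everywhere) a probability density, and a random variable $X_m$ with density $f_m$ has orthonormal polynomials $\phi_{0,m},\dots,\phi_{n-m,m}$ with $\deg\phi_{k,m}=k$ and positive leading coefficients. These satisfy $$\phi_{k+m}^{(m)}=\nu_k^{(m)}\,\phi_{k,m},\qquad k=0,1,\dots,n-m,$$ where $$\nu_k^{(m)}=\left\{\frac{\frac{(k+m)!}{k!}\prod_{j=k+m-1}^{k+2m-2}(1-j\delta)}{\mathbb E\,q^m(X)}\right\}^{1/2}>0$$ and an empty product is equal to one. In particular, with $\sigma^2=\operatorname{Var}X$, $$\phi_{k+1}'=\frac{\sqrt{(k+1)(1-k\delta)}}{\sigma}\,\phi_{k,1}=\sqrt{\frac{(k+1)(1-\delta)(1-k\delta)}{q(\mu)}}\;\phi_{k,1},\qquad k=0,1,\dots,n-1 .$$ -/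

import Mathlib

open MeasureTheory ProbabilityTheory Polynomial

noncomputable section

namespace IntegratedPearson

/-- The quadratic `q(x) = δ x² + β x + γ` (degenerate cases allowed). -/
def quad (δ β γ x : ℝ) : ℝ := δ * x ^ 2 + β * x + γ

/-- `X ∼ IP(μ; δ, β, γ)` with density `f`: the random variable `X` on `(Ω, P)` has the
Lebesgue density `f` and finite mean `μ`, the quadratic `q` is not identically zero, and
`∫_{-∞}^x (μ - t) f(t) dt = q(x) f(x)` for every real `x`. -/
structure IsIP {Ω : Type*} [MeasurableSpace Ω] (P : Measure Ω) (X : Ω → ℝ) (f : ℝ → ℝ)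
    (μ δ β γ : ℝ) : Prop where
  aemeasurable : AEMeasurable X P
  measurable_density : Measurable f
  density_nonneg : ∀ x, 0 ≤ f x
  law_eq : P.map X = volume.withDensity (fun x => ENNReal.ofReal (f x))
  integrable : Integrable X P
  mean_eq : ∫ w, X w ∂P = μ
  quad_ne_zero : 0 < |δ| + |β| + |γ|
  identity : ∀ x : ℝ, ∫ t in Set.Iic x, (μ - t) * f t = quad δ β γ x * f x

/-- `E q^m(X)`. -/
def expQuadPow {Ω : Type*} [MeasurableSpace Ω] (P : Measure Ω) (X : Ω → ℝ)
    (δ β γ : ℝ) (m : ℕ) : ℝ :=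
  ∫ w, quad δ β γ (X w) ^ m ∂P

/-- The law of `X_m`, i.e. the measure with Lebesgue density
`f_m(x) = q(x)^m f(x) / E q^m(X)`. (The density `f` vanishes almost everywhere outside the
interval of support of `X`, so no restriction to that interval is needed.) -/
def weightedLaw {Ω : Type*} [MeasurableSpace Ω] (P : Measure Ω) (X : Ω → ℝ) (f : ℝ → ℝ)
    (δ β γ : ℝ) (m : ℕ) : Measure ℝ :=
  volume.withDensity
    (fun x => ENNReal.ofReal (quad δ β γ x ^ m * f x / expQuadPow P X δ β γ m))

/-- `φ 0, …, φ N` are the orthonormal polynomials of the measure `ρ`, with positive leading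
coefficients. Since the diagonal integrals equal `1`, every `φ i` with `i ≤ N` is automatically
square integrable with respect to `ρ`, so all the integrals below are genuine. -/
structure IsOrthonormalPolynomials (ρ : Measure ℝ) (N : ℕ) (φ : ℕ → ℝ[X]) : Prop where
  natDegree_eq : ∀ k ≤ N, (φ k).natDegree = k
  leadingCoeff_pos : ∀ k ≤ N, 0 < (φ k).leadingCoeff
  orthonormal : ∀ i ≤ N, ∀ j ≤ N,
    ∫ x, (φ i).eval x * (φ j).eval x ∂ρ = if i = j then 1 else 0

/-- The closed form of `E q^m(X)` in terms of `μ` and `q`: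
`∏_{j<m} (1-2jδ) / ∏_{j<m} (1-(2j+1)δ) * ∏_{j<m} q((μ+jβ)/(1-2jδ))`. -/
def A (μ δ β γ : ℝ) (m : ℕ) : ℝ :=
  (∏ j ∈ Finset.range m, (1 - 2 * (j : ℝ) * δ)) /
      (∏ j ∈ Finset.range m, (1 - (2 * (j : ℝ) + 1) * δ)) *
    ∏ j ∈ Finset.range m, quad δ β γ ((μ + (j : ℝ) * β) / (1 - 2 * (j : ℝ) * δ))

/-- `ν_k^{(m)} = { ((k+m)!/k!) ∏_{j=k+m-1}^{k+2m-2} (1 - jδ) / E q^m(X) }^{1/2}`;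
the index `j` runs over integers, and the product is empty for `m = 0`. -/
def nu {Ω : Type*} [MeasurableSpace Ω] (P : Measure Ω) (X : Ω → ℝ)
    (δ β γ : ℝ) (k m : ℕ) : ℝ :=
  √((((k + m).factorial : ℝ) / (k.factorial : ℝ) *
      ∏ j ∈ Finset.Icc ((k : ℤ) + m - 1) ((k : ℤ) + 2 * m - 2), (1 - (j : ℝ) * δ)) /
    expQuadPow P X δ β γ m)

end IntegratedPearson

end

/-! The density `f` need not be smooth, but `q f` is a primitive of the integrable function `(μ - t)
f`, hence absolutely continuous on bounded intervals; it is nonnegative because `(μ - t) f` has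
total integral zero. Integrating by parts against a polynomial, with boundary terms removed by tail
estimates, gives the covariance identity `E (X - μ) g = E q g'` (`polyExp_sub_mean_mul`). Applied to
`q^m g`, it becomes the same kind of identity for the weight `q^m f`, with `x - μ` replaced by `(1 -
2mδ) x - (μ + mβ)` (`polyExp_quadPoly_pow_mul`).

Constant and linear `g` then yield a recursion for `E q^m` (`polyExp_quadPoly_pow_succ`). It gives
the closed form, and its factor `1 - (2m+1)δ` is forced to be positive, which is the necessity of
the moment condition. Sufficiency (`integrable_pow_mul`) comes from integrating by parts on `[μ - R,
μ + R]` against `(x - μ)^(2m+1)`: since `(2m+1)δ < 1`, the new moment is absorbed, uniformly in `R`.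

For the derivatives, `φ_K` pairs with polynomials of degree at most `K` as a multiple of their
`K`-th coefficient. Each integration by parts preserves this property for the next derivative, with
`K` lowered by one, one more factor `q` in the weight, and one more factor `1 - jδ` in the constant
(`polyExp_iterate_derivative`). So `φ_{k+m}^{(m)}` is orthogonal to all lower degrees under `q^m f`.
By uniqueness (`eq_sqrt_smul`) it is a multiple of `φ_{k,m}`, and pairing it with itself gives `ν`.
-/

namespace IntegratedPearson

/-! ### Analysis of the integrated equation: sign, tails and moments. -/

open Filter Topology Set

/-- The analytic content of `IsIP`, stated for the density alone. -/
structure IsPearsonDensity (f : ℝ → ℝ) (μ δ β γ : ℝ) : Prop where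
  measurable : Measurable f
  nonneg : ∀ x, 0 ≤ f x
  integrable : Integrable f
  integral_eq_one : ∫ x, f x = 1
  integrable_mul : Integrable fun x => x * f x
  mean_eq : ∫ x, x * f x = μ
  quad_ne_zero : 0 < |δ| + |β| + |γ|
  identity : ∀ x : ℝ, ∫ t in Iic x, (μ - t) * f t = quad δ β γ x * f x

namespace IsPearsonDensity

variable {f : ℝ → ℝ} {μ δ β γ : ℝ}

lemma integrable_dev (h : IsPearsonDensity f μ δ β γ) :
    Integrable fun t => (μ - t) * f t := by
  refine ((h.integrable.const_mul μ).sub h.integrable_mul).congr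
    (Eventually.of_forall fun t => ?_)
  simp only [Pi.sub_apply]
  ring

lemma integral_dev (h : IsPearsonDensity f μ δ β γ) : ∫ t, (μ - t) * f t = 0 := by
  simp only [sub_mul]
  rw [integral_sub (h.integrable.const_mul μ) h.integrable_mul, integral_const_mul,
    h.integral_eq_one, h.mean_eq]
  ring

lemma quad_mul_eq_integral_Ioi (h : IsPearsonDensity f μ δ β γ) (x : ℝ) :
    quad δ β γ x * f x = ∫ t in Ioi x, (t - μ) * f t := by
  have h1 := integral_add_compl (measurableSet_Iic (a := x)) h.integrable_dev
  rw [h.integral_dev, h.identity, compl_Iic] at h1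
  have h2 : ∫ t in Ioi x, (t - μ) * f t = - ∫ t in Ioi x, (μ - t) * f t := by
    rw [← integral_neg]
    congr 1 with t
    ring
  linarith

/-- Left of the mean the defining integrand is nonnegative; right of it the tail form is. -/
lemma quad_mul_nonneg (h : IsPearsonDensity f μ δ β γ) (x : ℝ) :
    0 ≤ quad δ β γ x * f x := by
  rcases le_total x μ with hx | hx
  · rw [← h.identity]
    exact setIntegral_nonneg measurableSet_Iic fun t ht =>
      mul_nonneg (sub_nonneg.2 (ht.out.trans hx)) (h.nonneg t)
  · rw [h.quad_mul_eq_integral_Ioi]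
    exact setIntegral_nonneg measurableSet_Ioi fun t ht =>
      mul_nonneg (sub_nonneg.2 (hx.trans (le_of_lt ht.out))) (h.nonneg t)

lemma quad_mul_eq_add (h : IsPearsonDensity f μ δ β γ) (a x : ℝ) :
    quad δ β γ x * f x = quad δ β γ a * f a + ∫ t in a..x, (μ - t) * f t := by
  rw [← h.identity, ← h.identity,
    ← intervalIntegral.integral_Iic_sub_Iic h.integrable_dev.integrableOn
      h.integrable_dev.integrableOn]
  ring

/-- Integration by parts against a polynomial on a bounded interval. -/
lemma integral_derivative_mul (h : IsPearsonDensity f μ δ β γ) (g : ℝ[X]) (a b : ℝ) :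
    ∫ x in a..b, (derivative g).eval x * (quad δ β γ x * f x) =
      g.eval b * (quad δ β γ b * f b) - g.eval a * (quad δ β γ a * f a)
        - ∫ x in a..b, g.eval x * ((μ - x) * f x) := by
  have hi : IntervalIntegrable (fun t => (μ - t) * f t) volume a b :=
    h.integrable_dev.intervalIntegrable
  have hF : (fun x => quad δ β γ x * f x) =
      fun x => quad δ β γ a * f a + ∫ t in a..x, (μ - t) * f t := funext (h.quad_mul_eq_add a)
  -- No regularity of `f` is known, so integration by parts rests on absolute continuity of the
  -- primitive `q f`.
  have hFac : AbsolutelyContinuousOnInterval (fun x => quad δ β γ x * f x) a b := by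
    rw [hF]
    exact (contDiffOn_const (n := 1)).absolutelyContinuousOnInterval.fun_add
      (hi.absolutelyContinuousOnInterval_intervalIntegral left_mem_uIcc)
  have hgac : AbsolutelyContinuousOnInterval (fun x => g.eval x) a b :=
    (g.contDiff_aeval (𝕜 := ℝ) 1).contDiffOn.absolutelyContinuousOnInterval
  have key := hFac.integral_mul_deriv_eq_deriv_mul hgac
  have h2 : ∫ x in a..b, deriv (fun x => quad δ β γ x * f x) x * g.eval x =
      ∫ x in a..b, g.eval x * ((μ - x) * f x) := by
    apply intervalIntegral.integral_congr_ae
    filter_upwards [hi.ae_hasDerivAt_integral] with x hx hxm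
    have := (hx (uIoc_subset_uIcc hxm) a left_mem_uIcc).const_add (quad δ β γ a * f a)
    rw [hF, this.deriv, mul_comm]
  rw [h2] at key
  rw [mul_comm (g.eval b), mul_comm (g.eval a), ← key]
  refine intervalIntegral.integral_congr fun x _ => ?_
  simp only [Polynomial.deriv]
  ring

lemma integrable_eval_mul (h : IsPearsonDensity f μ δ β γ) {N : ℕ}
    (hN : Integrable fun x => x ^ (2 * N) * f x) {p : ℝ[X]} (hp : p.natDegree ≤ 2 * N) :
    Integrable fun x => p.eval x * f x := by
  refine induction_with_natDegree_le (fun p => Integrable fun x => p.eval x * f x) (2 * N)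
    (by simp) ?_ ?_ p hp
  · intro k r _ hk
    refine ((h.integrable.add hN).const_mul |r|).mono'
      ((by fun_prop : Measurable fun x : ℝ => (C r * X ^ k : ℝ[X]).eval x).mul
        h.measurable).aestronglyMeasurable (Eventually.of_forall fun x => ?_)
    have hx : |x| ^ k ≤ 1 + x ^ (2 * N) := by
      rw [pow_mul, ← sq_abs, ← pow_mul]
      rcases le_total |x| 1 with h1 | h1
      · have := pow_le_one₀ (n := k) (abs_nonneg x) h1
        have := pow_nonneg (abs_nonneg x) (2 * N)
        linarith
      · have := pow_le_pow_right₀ h1 hk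
        linarith
    have := mul_le_mul_of_nonneg_left (mul_le_mul_of_nonneg_right hx (h.nonneg x)) (abs_nonneg r)
    simp only [eval_mul, eval_C, eval_pow, eval_X, norm_mul, norm_pow, Real.norm_eq_abs,
      abs_of_nonneg (h.nonneg x), Pi.add_apply]
    linarith
  · intro p q _ _ hp hq
    refine (hp.add hq).congr (Eventually.of_forall fun x => ?_)
    simp only [Pi.add_apply, eval_add]
    ring

/-- For large `x` the factor `x^k` may be moved inside the tail integral as `t^k ≥ x^k`; the result
is the tail of a convergent integral. -/
lemma tendsto_pow_mul_quad_mul_atTop (h : IsPearsonDensity f μ δ β γ) {N k : ℕ}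
    (hN : Integrable fun x => x ^ (2 * N) * f x) (hk : k + 1 ≤ 2 * N) :
    Tendsto (fun x => x ^ k * (quad δ β γ x * f x)) atTop (𝓝 0) := by
  have hi : Integrable fun t => t ^ k * ((t - μ) * f t) := by
    have := h.integrable_eval_mul hN (p := X ^ k * (X - C μ)) (by
      refine natDegree_mul_le.trans ?_
      simpa using hk)
    simpa [mul_assoc] using this
  refine squeeze_zero' ?_ ?_
    (tendsto_integral_Ioi_zero (f := fun t => t ^ k * ((t - μ) * f t)) (μ := volume) tendsto_id)
  · filter_upwards [eventually_ge_atTop 0] with x hx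
    exact mul_nonneg (pow_nonneg hx k) (h.quad_mul_nonneg x)
  · filter_upwards [eventually_ge_atTop 0, eventually_ge_atTop μ] with x hx hxm
    rw [h.quad_mul_eq_integral_Ioi, ← integral_const_mul]
    refine setIntegral_mono_on ?_ hi.integrableOn measurableSet_Ioi fun t ht => ?_
    · refine (Integrable.const_mul ?_ _).integrableOn
      refine h.integrable_dev.neg.congr (Eventually.of_forall fun t => ?_)
      simp only [Pi.neg_apply]
      ring
    · have ht' : x < t := ht
      exact mul_le_mul_of_nonneg_right (pow_le_pow_left₀ hx ht'.le k)
        (mul_nonneg (by linarith) (h.nonneg t))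

lemma tendsto_pow_mul_quad_mul_atBot (h : IsPearsonDensity f μ δ β γ) {N k : ℕ}
    (hN : Integrable fun x => x ^ (2 * N) * f x) (hk : k + 1 ≤ 2 * N) :
    Tendsto (fun x => x ^ k * (quad δ β γ x * f x)) atBot (𝓝 0) := by
  have hi : Integrable fun t => |t| ^ k * ((μ - t) * f t) := by
    have := (h.integrable_eval_mul hN (p := X ^ k * (C μ - X)) (by
      refine natDegree_mul_le.trans ?_
      have := natDegree_sub_le (C μ) (X : ℝ[X])
      simp at this ⊢
      omega)).norm
    refine this.mono ((by fun_prop : Measurable fun t : ℝ => |t| ^ k).mul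
      ((by fun_prop : Measurable fun t : ℝ => μ - t).mul h.measurable)).aestronglyMeasurable
      (Eventually.of_forall fun t => ?_)
    simp [mul_assoc]
  rw [tendsto_zero_iff_abs_tendsto_zero]
  refine squeeze_zero' (Eventually.of_forall fun x => abs_nonneg _) ?_
    (tendsto_integral_Iic_zero (f := fun t => |t| ^ k * ((μ - t) * f t)) (μ := volume) tendsto_id)
  filter_upwards [eventually_le_atBot 0, eventually_le_atBot μ] with x hx hxm
  simp only [Function.comp_apply, id]
  rw [abs_mul, abs_pow, abs_of_nonneg (h.quad_mul_nonneg x), ← h.identity, ← integral_const_mul]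
  refine setIntegral_mono_on (h.integrable_dev.const_mul _).integrableOn hi.integrableOn
    measurableSet_Iic fun t ht => ?_
  have ht' : t ≤ x := ht
  refine mul_le_mul_of_nonneg_right (pow_le_pow_left₀ (abs_nonneg x) ?_ k)
    (mul_nonneg (by linarith) (h.nonneg t))
  rw [abs_of_nonpos hx, abs_of_nonpos (ht'.trans hx)]
  linarith

/-- Finiteness of the even moments. -/
lemma integrable_pow_mul (h : IsPearsonDensity f μ δ β γ) (n : ℕ)
    (hδ : (2 * (n : ℝ) - 1) * δ < 1) : Integrable fun x => x ^ (2 * n) * f x := by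
  induction n with
  | zero => simpa using h.integrable
  | succ m ih =>
    have hm0 : (0 : ℝ) ≤ m := m.cast_nonneg
    have hδ' : (2 * (m : ℝ) + 1) * δ < 1 := by push_cast at hδ; linarith
    have hM : Integrable fun x => x ^ (2 * m) * f x := by
      -- For `m = 0` the inductive hypothesis would ask for `-δ < 1`, which can fail; the zeroth
      -- moment is available directly.
      rcases m.eq_zero_or_pos with rfl | hm
      · simpa using h.integrable
      · have : (1 : ℝ) ≤ m := by exact_mod_cast hm
        apply ih
        rcases le_total δ 0 with hd | hd <;> nlinarith
    have hMc : Integrable fun x => (x - μ) ^ (2 * m) * f x := by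
      have := h.integrable_eval_mul hM (p := (X - C μ) ^ (2 * m)) (by simp)
      simpa only [eval_pow, eval_sub, eval_X, eval_C] using this
    -- Half of the gap `2ε` absorbs the linear term of `q` about `μ`; the other half survives in
    -- front of the new moment.
    obtain ⟨ε, hε, hε2⟩ : ∃ ε > 0, 1 - (2 * (m : ℝ) + 1) * δ = 2 * ε :=
      ⟨(1 - (2 * (m : ℝ) + 1) * δ) / 2, by linarith, by ring⟩
    set b := (2 * (m : ℝ) + 1) * (2 * δ * μ + β) with hb
    set c := (2 * (m : ℝ) + 1) * |quad δ β γ μ| + b ^ 2 / (4 * ε) with hc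
    have hquad : ∀ x, (2 * (m : ℝ) + 1) * quad δ β γ x ≤ (1 - ε) * (x - μ) ^ 2 + c := by
      intro x
      have h1 : b * (x - μ) ≤ ε * (x - μ) ^ 2 + b ^ 2 / (4 * ε) := by
        have : ε * (x - μ) ^ 2 + b ^ 2 / (4 * ε) - b * (x - μ) =
            (2 * ε * (x - μ) - b) ^ 2 / (4 * ε) := by
          field_simp
          ring
        have h2 : 0 ≤ (2 * ε * (x - μ) - b) ^ 2 / (4 * ε) := by positivity
        linarith
      have h2 : (2 * (m : ℝ) + 1) * quad δ β γ μ ≤ (2 * (m : ℝ) + 1) * |quad δ β γ μ| :=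
        mul_le_mul_of_nonneg_left (le_abs_self _) (by linarith)
      have h3 : (2 * (m : ℝ) + 1) * quad δ β γ x = (2 * (m : ℝ) + 1) * quad δ β γ μ
          + b * (x - μ) + (1 - 2 * ε) * (x - μ) ^ 2 := by
        rw [← hε2, hb]
        simp only [quad]
        ring
      rw [h3]
      linarith
    have hc0 : 0 ≤ c := by positivity
    set M := ∫ x, (x - μ) ^ (2 * m) * f x with hMdef
    have hloc : ∀ (k : ℕ) (u v : ℝ), IntervalIntegrable (fun x => (x - μ) ^ k * f x) volume u v :=
      fun k u v => h.integrable.intervalIntegrable.continuousOn_mul (by fun_prop)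
    have hnn : ∀ (k : ℕ) x, 0 ≤ (x - μ) ^ (2 * k) * f x := fun k x =>
      mul_nonneg (by rw [pow_mul]; positivity) (h.nonneg x)
    have hbound : ∀ R : ℝ, 0 ≤ R →
        ∫ x in (μ - R)..(μ + R), (x - μ) ^ (2 * (m + 1)) * f x ≤ c * M / ε := by
      intro R hR
      have hle : μ - R ≤ μ + R := by linarith
      have hp := h.integral_derivative_mul ((X - C μ) ^ (2 * m + 1)) (μ - R) (μ + R)
      have e1 : ∫ x in (μ - R)..(μ + R), eval x (derivative ((X - C μ) ^ (2 * m + 1)))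
            * (quad δ β γ x * f x) =
          ∫ x in (μ - R)..(μ + R), (2 * (m : ℝ) + 1) * quad δ β γ x *
            ((x - μ) ^ (2 * m) * f x) := by
        refine intervalIntegral.integral_congr fun x _ => ?_
        simp [derivative_pow]
        ring
      have e2 : ∫ x in (μ - R)..(μ + R), eval x ((X - C μ) ^ (2 * m + 1)) * ((μ - x) * f x) =
          - ∫ x in (μ - R)..(μ + R), (x - μ) ^ (2 * (m + 1)) * f x := by
        rw [← intervalIntegral.integral_neg]
        refine intervalIntegral.integral_congr fun x _ => ?_
        simp
        ring
      rw [e1, e2] at hp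
      -- The odd power makes both boundary terms have the favourable sign, so no decay is needed
      -- here.
      have e3 : 0 ≤ eval (μ + R) ((X - C μ) ^ (2 * m + 1)) * (quad δ β γ (μ + R) * f (μ + R)) := by
        refine mul_nonneg ?_ (h.quad_mul_nonneg _)
        simp [hR]
      have e4 : eval (μ - R) ((X - C μ) ^ (2 * m + 1)) * (quad δ β γ (μ - R) * f (μ - R)) ≤ 0 := by
        refine mul_nonpos_of_nonpos_of_nonneg ?_ (h.quad_mul_nonneg _)
        have : Odd (2 * m + 1) := odd_two_mul_add_one m
        simp [this.neg_pow, hR]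
      have e5 : ∫ x in (μ - R)..(μ + R), (2 * (m : ℝ) + 1) * quad δ β γ x *
            ((x - μ) ^ (2 * m) * f x) ≤
          ∫ x in (μ - R)..(μ + R), ((1 - ε) * ((x - μ) ^ (2 * (m + 1)) * f x) +
            c * ((x - μ) ^ (2 * m) * f x)) := by
        refine intervalIntegral.integral_mono_on hle ((hloc _ _ _).continuousOn_mul ?_)
          (((hloc _ _ _).const_mul _).add ((hloc _ _ _).const_mul _)) fun x _ => ?_
        · simp only [quad]
          fun_prop
        · have := mul_le_mul_of_nonneg_right (hquad x) (hnn m x)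
          refine this.trans (le_of_eq ?_)
          ring
      rw [intervalIntegral.integral_add ((hloc _ _ _).const_mul _) ((hloc _ _ _).const_mul _),
        intervalIntegral.integral_const_mul, intervalIntegral.integral_const_mul] at e5
      have e6 : ∫ x in (μ - R)..(μ + R), (x - μ) ^ (2 * m) * f x ≤ M := by
        rw [intervalIntegral.integral_of_le hle]
        exact setIntegral_le_integral hMc (Eventually.of_forall (hnn m))
      have e7 := mul_le_mul_of_nonneg_left e6 hc0
      rw [le_div_iff₀ hε]
      linarith
    have hcent : Integrable fun x => (x - μ) ^ (2 * (m + 1)) * f x := by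
      refine integrable_of_intervalIntegral_norm_bounded (l := atTop) (a := fun R : ℝ => μ - R)
        (b := fun R => μ + R) (c * M / ε) (fun R => ?_)
        (tendsto_atBot_add_const_left _ μ tendsto_neg_atTop_atBot) (tendsto_atTop_add_const_left _ _ tendsto_id) ?_
      · exact (hloc _ _ _).1
      · filter_upwards [eventually_ge_atTop 0] with R hR
        simpa only [Real.norm_of_nonneg (hnn _ _)] using hbound R hR
    refine ((hcent.add (h.integrable.const_mul (μ ^ (2 * (m + 1))))).const_mul
      (2 ^ (2 * (m + 1)))).mono'
      ((by fun_prop : Measurable fun x : ℝ => x ^ (2 * (m + 1))).mul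
        h.measurable).aestronglyMeasurable (Eventually.of_forall fun x => ?_)
    -- Passage from the central moment back to the raw one.
    have hx : x ^ (2 * (m + 1)) ≤
        2 ^ (2 * (m + 1)) * ((x - μ) ^ (2 * (m + 1)) + μ ^ (2 * (m + 1))) := by
      have h1 := (even_two_mul (m + 1)).add_pow_le (a := x - μ) (b := μ)
      rw [sub_add_cancel] at h1
      refine h1.trans (mul_le_mul_of_nonneg_right
        (pow_le_pow_right₀ one_le_two (Nat.sub_le _ _)) ?_)
      rw [pow_mul, pow_mul]
      positivity
    rw [Real.norm_of_nonneg (mul_nonneg (by rw [pow_mul]; positivity) (h.nonneg x))]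
    simp only [Pi.add_apply]
    nlinarith [mul_le_mul_of_nonneg_right hx (h.nonneg x)]

end IsPearsonDensity
end IntegratedPearson

/-! ### The moment functional on polynomials, covariance identities and the recursion for `E q^m`.
-/

namespace IntegratedPearson

open Filter Topology Set

/-- The quadratic `δ x² + β x + γ` as a polynomial. -/
noncomputable def quadPoly (δ β γ : ℝ) : ℝ[X] := C δ * X ^ 2 + C β * X + C γ

/-- The linear functional `p ↦ ∫ p(x) f(x) dx` on polynomials. -/
noncomputable def polyExp (f : ℝ → ℝ) (p : ℝ[X]) : ℝ := ∫ x, p.eval x * f x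

@[simp] lemma eval_quadPoly (δ β γ x : ℝ) : (quadPoly δ β γ).eval x = quad δ β γ x := by
  simp [quadPoly, quad]

lemma natDegree_quadPoly_le (δ β γ : ℝ) : (quadPoly δ β γ).natDegree ≤ 2 :=
  natDegree_quadratic_le

lemma derivative_quadPoly (δ β γ : ℝ) :
    derivative (quadPoly δ β γ) = C (2 * δ) * X + C β := by
  simp only [quadPoly, derivative_add, derivative_C_mul, derivative_X_sq, derivative_X,
    derivative_C, C_mul]
  ring

lemma natDegree_quadPoly_pow_le (δ β γ : ℝ) (m : ℕ) :
    (quadPoly δ β γ ^ m).natDegree ≤ 2 * m := by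
  refine (natDegree_pow_le_of_le m (natDegree_quadPoly_le δ β γ)).trans ?_
  omega

lemma polyExp_C_mul (f : ℝ → ℝ) (r : ℝ) (p : ℝ[X]) : polyExp f (C r * p) = r * polyExp f p := by
  simp only [polyExp, eval_mul, eval_C, mul_assoc]
  rw [integral_const_mul]

namespace IsPearsonDensity

variable {f : ℝ → ℝ} {μ δ β γ : ℝ}

lemma quadPoly_ne_zero (h : IsPearsonDensity f μ δ β γ) : quadPoly δ β γ ≠ 0 := by
  intro h0
  have h2 : (quadPoly δ β γ).coeff 2 = δ := by simp [quadPoly]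
  have h1 : (quadPoly δ β γ).coeff 1 = β := by simp [quadPoly, coeff_C]
  have h3 : (quadPoly δ β γ).coeff 0 = γ := by simp [quadPoly]
  rw [h0, coeff_zero] at h1 h2 h3
  simpa [← h1, ← h2, ← h3] using h.quad_ne_zero

lemma ae_eval_ne_zero {p : ℝ[X]} (hp : p ≠ 0) : ∀ᵐ x : ℝ, p.eval x ≠ 0 := by
  have : {x : ℝ | p.eval x = 0}.Finite := by
    refine (p.roots.toFinset.finite_toSet).subset fun x hx => ?_
    simpa [hp] using hx
  simpa [ae_iff] using this.measure_zero volume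

/-- Nonnegativity of `q f` gives `q ≥ 0` where `f > 0`, and `q` has only finitely many zeros. -/
lemma ae_quad_pos (h : IsPearsonDensity f μ δ β γ) : ∀ᵐ x : ℝ, f x ≠ 0 → 0 < quad δ β γ x := by
  filter_upwards [ae_eval_ne_zero h.quadPoly_ne_zero] with x hx hf
  rw [eval_quadPoly] at hx
  have hfx : 0 < f x := lt_of_le_of_ne (h.nonneg x) hf.symm
  have := nonneg_of_mul_nonneg_left (h.quad_mul_nonneg x) hfx
  exact lt_of_le_of_ne this hx.symm

variable {N : ℕ}

lemma polyExp_add (h : IsPearsonDensity f μ δ β γ)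
    (hN : Integrable fun x => x ^ (2 * N) * f x) {p q : ℝ[X]} (hp : p.natDegree ≤ 2 * N)
    (hq : q.natDegree ≤ 2 * N) : polyExp f (p + q) = polyExp f p + polyExp f q := by
  simp only [polyExp, eval_add, add_mul]
  exact integral_add (h.integrable_eval_mul hN hp) (h.integrable_eval_mul hN hq)

/-- A zero integral would make `p f` vanish almost everywhere, hence also `f`, since `p` has
finitely many roots; this contradicts total mass one. -/
lemma polyExp_pos (h : IsPearsonDensity f μ δ β γ)
    (hN : Integrable fun x => x ^ (2 * N) * f x) {p : ℝ[X]} (hp : p.natDegree ≤ 2 * N)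
    (hp0 : p ≠ 0) (hpn : ∀ᵐ x : ℝ, f x ≠ 0 → 0 ≤ p.eval x) : 0 < polyExp f p := by
  have hnn : 0 ≤ᵐ[volume] fun x => p.eval x * f x := by
    filter_upwards [hpn] with x hx
    by_cases hf : f x = 0
    · simp [hf]
    · exact mul_nonneg (hx hf) (h.nonneg x)
  refine lt_of_le_of_ne (integral_nonneg_of_ae hnn) fun h0 => ?_
  have hz := (integral_eq_zero_iff_of_nonneg_ae hnn (h.integrable_eval_mul hN hp)).1 h0.symm
  have hf0 : f =ᵐ[volume] 0 := by
    filter_upwards [hz, ae_eval_ne_zero hp0] with x hx hx'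
    exact (mul_eq_zero.1 hx).resolve_left hx'
  have := h.integral_eq_one
  rw [integral_congr_ae hf0] at this
  simp at this

lemma polyExp_quadPoly_pow_pos (h : IsPearsonDensity f μ δ β γ)
    (hN : Integrable fun x => x ^ (2 * N) * f x) {m : ℕ} (hm : m ≤ N) :
    0 < polyExp f (quadPoly δ β γ ^ m) := by
  refine h.polyExp_pos hN ((natDegree_quadPoly_pow_le _ _ _ _).trans (by omega))
    (pow_ne_zero _ h.quadPoly_ne_zero) ?_
  filter_upwards [h.ae_quad_pos] with x hx hf
  rw [eval_pow, eval_quadPoly]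
  exact pow_nonneg (hx hf).le m

/-- The covariance identity `E (X - μ) g(X) = E q(X) g'(X)`. -/
lemma polyExp_sub_mean_mul (h : IsPearsonDensity f μ δ β γ)
    (hN : Integrable fun x => x ^ (2 * N) * f x) {g : ℝ[X]} (hg : g.natDegree + 1 ≤ 2 * N) :
    polyExp f ((X - C μ) * g) = polyExp f (quadPoly δ β γ * derivative g) := by
  have hN1 : 1 ≤ 2 * N := by omega
  have hdeg1 : ∀ g : ℝ[X], g.natDegree ≤ 2 * N - 1 → ((X - C μ) * g).natDegree ≤ 2 * N := by
    intro g hg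
    refine natDegree_mul_le.trans ?_
    rw [natDegree_X_sub_C]
    omega
  have hdeg2 : ∀ g : ℝ[X], g.natDegree ≤ 2 * N - 1 →
      (quadPoly δ β γ * derivative g).natDegree ≤ 2 * N := by
    intro g hg
    rcases Nat.eq_zero_or_pos g.natDegree with h0 | h0
    · rw [derivative_of_natDegree_zero h0]
      simp
    · refine natDegree_mul_le.trans ?_
      have := natDegree_quadPoly_le δ β γ
      have := natDegree_derivative_le g
      omega
  refine induction_with_natDegree_le (fun g => polyExp f ((X - C μ) * g) =
    polyExp f (quadPoly δ β γ * derivative g)) (2 * N - 1) (by simp) ?_ ?_ g (by omega)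
  · intro k r _ hk
    suffices hs : polyExp f ((X - C μ) * X ^ k) =
        polyExp f (quadPoly δ β γ * derivative (X ^ k)) by
      rw [derivative_C_mul, mul_left_comm, mul_left_comm (quadPoly δ β γ), polyExp_C_mul,
        polyExp_C_mul, hs]
    have i1 := h.integrable_eval_mul hN (hdeg1 (X ^ k) (by simpa using hk))
    have i2 := h.integrable_eval_mul hN (hdeg2 (X ^ k) (by simpa using hk))
    have t1 := intervalIntegral_tendsto_integral i1 tendsto_neg_atTop_atBot tendsto_id
    have t2 := intervalIntegral_tendsto_integral i2 tendsto_neg_atTop_atBot tendsto_id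
    have b1 := h.tendsto_pow_mul_quad_mul_atTop hN (k := k) (by omega)
    have b2 := (h.tendsto_pow_mul_quad_mul_atBot hN (k := k) (by omega)).comp
      tendsto_neg_atTop_atBot
    have t3 := (b1.sub b2).add t1
    rw [sub_zero, zero_add] at t3
    refine tendsto_nhds_unique t3 (t2.congr fun R => ?_)
    have e := h.integral_derivative_mul (X ^ k) (-R) R
    have e1 : ∫ x in (-R)..R, eval x (quadPoly δ β γ * derivative (X ^ k)) * f x =
        ∫ x in (-R)..R, eval x (derivative (X ^ k)) * (quad δ β γ x * f x) := by
      refine intervalIntegral.integral_congr fun x _ => ?_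
      simp only [eval_mul, eval_quadPoly]
      ring
    have e2 : ∫ x in (-R)..R, eval x ((X - C μ) * X ^ k) * f x =
        - ∫ x in (-R)..R, eval x (X ^ k) * ((μ - x) * f x) := by
      rw [← intervalIntegral.integral_neg]
      refine intervalIntegral.integral_congr fun x _ => ?_
      simp only [eval_mul, eval_sub, eval_X, eval_C]
      ring
    simp only [id, e1, e2, e, eval_pow, eval_X, Function.comp_apply]
    ring
  · intro p q hpq hq ihp ihq
    rw [derivative_add, mul_add, mul_add,
      h.polyExp_add hN (hdeg1 p (by omega)) (hdeg1 q hq),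
      h.polyExp_add hN (hdeg2 p (by omega)) (hdeg2 q hq), ihp, ihq]

/-- The covariance identity for the density proportional to `q ^ m * f`. -/
lemma polyExp_quadPoly_pow_mul (h : IsPearsonDensity f μ δ β γ)
    (hN : Integrable fun x => x ^ (2 * N) * f x) {g : ℝ[X]} {m : ℕ}
    (hg : 2 * m + g.natDegree + 1 ≤ 2 * N) :
    polyExp f (quadPoly δ β γ ^ m * ((C (1 - 2 * m * δ) * X - C (μ + m * β)) * g)) =
      polyExp f (quadPoly δ β γ ^ (m + 1) * derivative g) := by
  have hQ := natDegree_quadPoly_pow_le δ β γ m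
  have hQg : (quadPoly δ β γ ^ m * g).natDegree ≤ 2 * m + g.natDegree :=
    natDegree_mul_le.trans (by omega)
  have hL : ∀ a b : ℝ, (C a * X + C b : ℝ[X]).natDegree ≤ 1 := fun a b => natDegree_linear_le
  have d1 : (quadPoly δ β γ ^ m *
      ((C (1 - 2 * m * δ) * X - C (μ + m * β)) * g)).natDegree ≤ 2 * N := by
    refine natDegree_mul_le.trans ?_
    have h1 := natDegree_mul_le (p := (C (1 - 2 * m * δ) * X - C (μ + m * β) : ℝ[X])) (q := g)
    have h2 := hL (1 - 2 * m * δ) (-(μ + m * β))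
    rw [C_neg, ← sub_eq_add_neg] at h2
    omega
  have d2 : (quadPoly δ β γ ^ m * (C (m : ℝ) * (C (2 * δ) * X + C β) * g)).natDegree ≤ 2 * N := by
    refine natDegree_mul_le.trans ?_
    have h1 := natDegree_mul_le (p := (C (m : ℝ) * (C (2 * δ) * X + C β) : ℝ[X])) (q := g)
    have h2 := (natDegree_C_mul_le (m : ℝ) (C (2 * δ) * X + C β)).trans (hL (2 * δ) β)
    omega
  have d3 : (quadPoly δ β γ ^ (m + 1) * derivative g).natDegree ≤ 2 * N := by
    rcases Nat.eq_zero_or_pos g.natDegree with h0 | h0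
    · rw [derivative_of_natDegree_zero h0]
      simp
    · refine natDegree_mul_le.trans ?_
      have := natDegree_quadPoly_pow_le δ β γ (m + 1)
      have := natDegree_derivative_le g
      omega
  -- The product rule on `q^m g` produces `m q^m q' g`; moving it to the left changes `x - μ` into
  -- `(1 - 2mδ) x - (μ + mβ)`.
  have key := h.polyExp_sub_mean_mul hN (g := quadPoly δ β γ ^ m * g) (by omega)
  have e1 : (X - C μ) * (quadPoly δ β γ ^ m * g) =
      quadPoly δ β γ ^ m * ((C (1 - 2 * m * δ) * X - C (μ + m * β)) * g) +
      quadPoly δ β γ ^ m * (C (m : ℝ) * (C (2 * δ) * X + C β) * g) := by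
    simp only [map_sub, map_add, map_mul, map_one, map_ofNat, map_natCast]
    ring
  have e2 : quadPoly δ β γ * derivative (quadPoly δ β γ ^ m * g) =
      quadPoly δ β γ ^ (m + 1) * derivative g +
      quadPoly δ β γ ^ m * (C (m : ℝ) * (C (2 * δ) * X + C β) * g) := by
    rw [derivative_mul, derivative_pow, derivative_quadPoly]
    rcases m with _ | m
    · simp
    · simp only [Nat.add_sub_cancel]
      ring
  rw [e1, e2, h.polyExp_add hN d1 d2, h.polyExp_add hN d3 d2] at key
  linarith

/-- The quadratic is positive at the mean of the density proportional to `q ^ m * f`. -/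
lemma quad_pos_of_mean (h : IsPearsonDensity f μ δ β γ)
    (hN : Integrable fun x => x ^ (2 * N) * f x) {m : ℕ} (hm : m + 1 ≤ N) {c : ℝ}
    (hc : polyExp f (quadPoly δ β γ ^ m * (X - C c)) = 0) : 0 < quad δ β γ c := by
  by_contra! hq
  -- If `q(c) ≤ 0` then `q f` vanishes at `c`. The integral on the side of `c` away from `μ` is then
  -- zero, so `f` has no mass there and `c` cannot be the weighted mean.
  have hF : quad δ β γ c * f c = 0 :=
    le_antisymm (mul_nonpos_of_nonpos_of_nonneg hq (h.nonneg c)) (h.quad_mul_nonneg c)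
  have hdeg : (quadPoly δ β γ ^ m * (X - C c)).natDegree ≤ 2 * N := by
    refine natDegree_mul_le.trans ?_
    have := natDegree_quadPoly_pow_le δ β γ m
    rw [natDegree_X_sub_C]
    omega
  have hne : quadPoly δ β γ ^ m * (X - C c) ≠ 0 :=
    mul_ne_zero (pow_ne_zero _ h.quadPoly_ne_zero) (X_sub_C_ne_zero c)
  have hμ : ∀ᵐ x : ℝ, x ≠ μ := by simp [ae_iff, measure_singleton]
  rcases le_total c μ with hcμ | hcμ
  · have h1 := h.identity c
    rw [hF, setIntegral_eq_zero_iff_of_nonneg_ae ((ae_restrict_iff' measurableSet_Iic).2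
      (Eventually.of_forall fun t ht => mul_nonneg (sub_nonneg.2 (ht.out.trans hcμ)) (h.nonneg t)))
      h.integrable_dev.integrableOn, EventuallyEq, ae_restrict_iff' measurableSet_Iic] at h1
    refine (h.polyExp_pos hN hdeg hne ?_).ne' hc
    filter_upwards [h1, hμ, h.ae_quad_pos] with x hx hxμ hqx hfx
    have hxc : c < x := by
      by_contra! hxc
      rcases mul_eq_zero.1 (hx hxc) with h2 | h2
      · exact hxμ (by linarith)
      · exact hfx h2
    simp only [eval_mul, eval_pow, eval_quadPoly, eval_sub, eval_X, eval_C]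
    exact mul_nonneg (pow_nonneg (hqx hfx).le m) (by linarith)
  · have h1 := h.quad_mul_eq_integral_Ioi c
    have hint : Integrable fun t => (t - μ) * f t := by
      refine h.integrable_dev.neg.congr (Eventually.of_forall fun t => ?_)
      simp only [Pi.neg_apply]
      ring
    rw [hF, eq_comm, setIntegral_eq_zero_iff_of_nonneg_ae ((ae_restrict_iff' measurableSet_Ioi).2
      (Eventually.of_forall fun t ht => mul_nonneg (sub_nonneg.2 (hcμ.trans (le_of_lt ht.out)))
        (h.nonneg t)))
      hint.integrableOn, EventuallyEq, ae_restrict_iff' measurableSet_Ioi] at h1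
    have hneg : 0 < polyExp f (C (-1) * (quadPoly δ β γ ^ m * (X - C c))) := by
      refine h.polyExp_pos hN ((natDegree_C_mul_le _ _).trans hdeg)
        (mul_ne_zero (by simp) hne) ?_
      filter_upwards [h1, hμ, h.ae_quad_pos] with x hx hxμ hqx hfx
      have hxc : x ≤ c := by
        by_contra! hxc
        rcases mul_eq_zero.1 (hx hxc) with h2 | h2
        · exact hxμ (by linarith)
        · exact hfx h2
      simp only [eval_mul, eval_pow, eval_quadPoly, eval_sub, eval_X, eval_C]
      have := mul_nonneg (pow_nonneg (hqx hfx).le m) (sub_nonneg.2 hxc)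
      linarith
    rw [polyExp_C_mul, hc] at hneg
    simp at hneg

/-- The recursion for `E q ^ m`, together with the positivity of its factors. -/
lemma polyExp_quadPoly_pow_succ (h : IsPearsonDensity f μ δ β γ)
    (hN : Integrable fun x => x ^ (2 * N) * f x) {m : ℕ} (hm : m + 1 ≤ N) :
    0 < 1 - 2 * (m : ℝ) * δ ∧ 0 < 1 - (2 * (m : ℝ) + 1) * δ ∧
      0 < quad δ β γ ((μ + m * β) / (1 - 2 * m * δ)) ∧
      (1 - (2 * (m : ℝ) + 1) * δ) * polyExp f (quadPoly δ β γ ^ (m + 1)) =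
        (1 - 2 * (m : ℝ) * δ) * quad δ β γ ((μ + m * β) / (1 - 2 * m * δ)) *
          polyExp f (quadPoly δ β γ ^ m) := by
  have hE := h.polyExp_quadPoly_pow_pos hN (m := m) (by omega)
  have hE' := h.polyExp_quadPoly_pow_pos hN hm
  have s1 := h.polyExp_quadPoly_pow_mul hN (g := 1) (m := m) (by simp; omega)
  have s2 := fun c => h.polyExp_quadPoly_pow_mul hN (g := X - C c) (m := m)
    (by rw [natDegree_X_sub_C]; omega)
  have hpX : polyExp f 0 = 0 := by simp [polyExp]
  rw [derivative_one, mul_zero, mul_one, hpX] at s1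
  simp only [derivative_X_sub_C, mul_one] at s2
  set a := 1 - 2 * (m : ℝ) * δ with ha
  set b := μ + m * β with hb
  -- If `a = 0`, constant `g` forces `b = 0`, and then `g = X` gives `E q^(m+1) = 0`.
  have ha0 : a ≠ 0 := by
    intro ha0
    rw [ha0, C_0, zero_mul, zero_sub, ← C_neg, mul_comm, polyExp_C_mul] at s1
    have hb0 : b = 0 := by
      rcases mul_eq_zero.1 s1 with h1 | h1
      · linarith
      · exact absurd h1 hE.ne'
    have := s2 0
    rw [ha0, hb0, C_0, zero_mul, zero_sub, neg_zero, zero_mul, mul_zero, hpX] at this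
    linarith
  set c := b / a with hcdef
  have hlin : (C a * X - C b : ℝ[X]) = C a * (X - C c) := by
    rw [mul_sub, ← C_mul, hcdef, mul_div_cancel₀ _ ha0]
  rw [hlin, mul_left_comm, polyExp_C_mul] at s1
  have hc : polyExp f (quadPoly δ β γ ^ m * (X - C c)) = 0 :=
    (mul_eq_zero.1 s1).resolve_left ha0
  have hsq := s2 c
  rw [hlin, mul_assoc, mul_left_comm, polyExp_C_mul, ← sq] at hsq
  have d1 : (quadPoly δ β γ ^ m).natDegree ≤ 2 * m := natDegree_quadPoly_pow_le δ β γ m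
  have d2 : (quadPoly δ β γ ^ m * (X - C c)).natDegree ≤ 2 * N := by
    refine natDegree_mul_le.trans ?_
    rw [natDegree_X_sub_C]
    omega
  have d3 : (quadPoly δ β γ ^ m * (X - C c) ^ 2).natDegree ≤ 2 * N := by
    refine natDegree_mul_le.trans ?_
    rw [natDegree_pow (X - C c), natDegree_X_sub_C]
    omega
  have hsqpos : 0 < polyExp f (quadPoly δ β γ ^ m * (X - C c) ^ 2) := by
    refine h.polyExp_pos hN d3 (mul_ne_zero (pow_ne_zero _ h.quadPoly_ne_zero)
      (pow_ne_zero _ (X_sub_C_ne_zero c))) ?_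
    filter_upwards [h.ae_quad_pos] with x hx hf
    simp only [eval_mul, eval_pow, eval_quadPoly, eval_sub, eval_X, eval_C]
    exact mul_nonneg (pow_nonneg (hx hf).le m) (sq_nonneg _)
  have hapos : 0 < a := by
    by_contra! hcon
    have := mul_nonpos_of_nonpos_of_nonneg hcon hsqpos.le
    linarith
  have hq := h.quad_pos_of_mean hN hm hc
  -- Taylor expansion of one factor `q` about the weighted mean `c`; the linear term integrates to
  -- zero. Together with `hsq` this eliminates the weighted second central moment.
  have hexp : quadPoly δ β γ ^ (m + 1) = C (quad δ β γ c) * quadPoly δ β γ ^ m +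
      C (2 * δ * c + β) * (quadPoly δ β γ ^ m * (X - C c)) +
      C δ * (quadPoly δ β γ ^ m * (X - C c) ^ 2) := by
    have : quadPoly δ β γ = C (quad δ β γ c) + C (2 * δ * c + β) * (X - C c) +
        C δ * (X - C c) ^ 2 := by
      simp only [quadPoly, quad, map_add, map_mul, map_pow, map_ofNat]
      ring
    rw [pow_succ]
    nth_rw 2 [this]
    ring
  have hrec : polyExp f (quadPoly δ β γ ^ (m + 1)) =
      quad δ β γ c * polyExp f (quadPoly δ β γ ^ m) +
        δ * polyExp f (quadPoly δ β γ ^ m * (X - C c) ^ 2) := by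
    rw [hexp, h.polyExp_add hN _ ((natDegree_C_mul_le _ _).trans d3),
      h.polyExp_add hN ((natDegree_C_mul_le _ _).trans (d1.trans (by omega)))
        ((natDegree_C_mul_le _ _).trans d2), polyExp_C_mul, polyExp_C_mul, polyExp_C_mul, hc]
    · ring
    · exact natDegree_add_le_of_degree_le
        ((natDegree_C_mul_le _ _).trans (d1.trans (by omega))) ((natDegree_C_mul_le _ _).trans d2)
  have hfin : (1 - (2 * (m : ℝ) + 1) * δ) * polyExp f (quadPoly δ β γ ^ (m + 1)) =
      a * quad δ β γ c * polyExp f (quadPoly δ β γ ^ m) := by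
    have : 1 - (2 * (m : ℝ) + 1) * δ = a - δ := by rw [ha]; ring
    rw [this]
    linear_combination a * hrec + δ * hsq
  refine ⟨hapos, ?_, hq, hfin⟩
  have hpos : 0 < a * quad δ β γ c * polyExp f (quadPoly δ β γ ^ m) := by positivity
  rw [← hfin] at hpos
  exact pos_of_mul_pos_left hpos hE'.le

lemma polyExp_quadPoly_pow_eq (h : IsPearsonDensity f μ δ β γ)
    (hN : Integrable fun x => x ^ (2 * N) * f x) {m : ℕ} (hm : m ≤ N) :
    polyExp f (quadPoly δ β γ ^ m) = A μ δ β γ m := by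
  induction m with
  | zero => simp [A, polyExp, h.integral_eq_one]
  | succ m ih =>
    obtain ⟨_, h2, _, h4⟩ := h.polyExp_quadPoly_pow_succ hN hm
    rw [ih (by omega)] at h4
    rw [mul_comm, ← eq_div_iff h2.ne'] at h4
    rw [h4, A, A, Finset.prod_range_succ, Finset.prod_range_succ, Finset.prod_range_succ]
    field_simp

end IsPearsonDensity
end IntegratedPearson

/-! ### Orthonormal polynomials of a general measure: uniqueness and existence. -/

namespace IntegratedPearson

/-- `ρ` has finite moments up to order `2 N` and is not supported on the zeros of a nonzero
polynomial of degree at most `N`. -/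
structure HasOrthogonality (ρ : Measure ℝ) (N : ℕ) : Prop where
  integrable : ∀ p : ℝ[X], p.natDegree ≤ 2 * N → Integrable (fun x => p.eval x) ρ
  sq_pos : ∀ p : ℝ[X], p.natDegree ≤ N → p ≠ 0 → 0 < ∫ x, p.eval x * p.eval x ∂ρ

namespace HasOrthogonality

variable {ρ : Measure ℝ} {N : ℕ}

lemma integrable_mul (h : HasOrthogonality ρ N) {p q : ℝ[X]} (hp : p.natDegree ≤ N)
    (hq : q.natDegree ≤ N) : Integrable (fun x => p.eval x * q.eval x) ρ := by
  have := h.integrable (p * q) (natDegree_mul_le.trans (by omega))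
  simpa only [eval_mul] using this

lemma integral_mul_add (h : HasOrthogonality ρ N) {p q r : ℝ[X]} (hp : p.natDegree ≤ N)
    (hq : q.natDegree ≤ N) (hr : r.natDegree ≤ N) :
    ∫ x, p.eval x * (q + r).eval x ∂ρ =
      ∫ x, p.eval x * q.eval x ∂ρ + ∫ x, p.eval x * r.eval x ∂ρ := by
  simp only [eval_add, mul_add]
  exact integral_add (h.integrable_mul hp hq) (h.integrable_mul hp hr)

lemma integral_mul_C_mul (p q : ℝ[X]) (c : ℝ) :
    ∫ x, p.eval x * (C c * q).eval x ∂ρ = c * ∫ x, p.eval x * q.eval x ∂ρ := by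
  rw [← integral_const_mul]
  congr 1 with x
  simp only [eval_mul, eval_C]
  ring

end HasOrthogonality

/-- Subtracting a suitable multiple of `q` from `p` lowers the degree. -/
lemma degree_sub_C_mul_lt {p q : ℝ[X]} {k : ℕ} (hp : p.natDegree ≤ k) (hq : q.natDegree = k)
    (hq0 : q ≠ 0) : (p - C (p.coeff k / q.leadingCoeff) * q).degree < k := by
  rw [degree_lt_iff_coeff_zero]
  intro j hj
  rw [coeff_sub, coeff_C_mul]
  rcases hj.eq_or_lt with hj | hj
  · rw [← hj]
    have : q.coeff k = q.leadingCoeff := by rw [leadingCoeff, hq]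
    rw [this, div_mul_cancel₀ _ (leadingCoeff_ne_zero.2 hq0), sub_self]
  · rw [coeff_eq_zero_of_natDegree_lt (p := p) (n := j) (by omega),
      coeff_eq_zero_of_natDegree_lt (p := q) (n := j) (by omega), mul_zero, sub_zero]

namespace IsOrthonormalPolynomials

variable {ρ : Measure ℝ} {N : ℕ} {φ : ℕ → ℝ[X]}

lemma ne_zero (hφ : IsOrthonormalPolynomials ρ N φ) {k : ℕ} (hk : k ≤ N) : φ k ≠ 0 :=
  leadingCoeff_ne_zero.1 (hφ.leadingCoeff_pos k hk).ne'

/-- Induction on the degree bound: subtract the multiple of `φ j` that cancels the top coefficient.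
-/
lemma integral_mul_eq_zero_of_degree_lt (h : HasOrthogonality ρ N)
    (hφ : IsOrthonormalPolynomials ρ N φ) {k : ℕ} (hk : k ≤ N) {p : ℝ[X]} {j : ℕ} (hj : j ≤ k)
    (hp : p.degree < j) : ∫ x, (φ k).eval x * p.eval x ∂ρ = 0 := by
  induction j generalizing p with
  | zero =>
    have : p = 0 := by simpa using hp
    simp [this]
  | succ j ih =>
    have hpj : p.natDegree ≤ j := 
      natDegree_le_iff_coeff_eq_zero.2 fun i hi => (degree_lt_iff_coeff_zero _ _).1 hp i hi
    have hjN : j ≤ N := by omega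
    have hdeg := degree_sub_C_mul_lt hpj (hφ.natDegree_eq j hjN) (hφ.ne_zero hjN)
    have h0 := ih (by omega) hdeg
    set c := p.coeff j / (φ j).leadingCoeff
    have hs : p = (p - C c * φ j) + C c * φ j := by ring
    rw [hs, h.integral_mul_add (by rw [hφ.natDegree_eq k hk]; exact hk), h0,
      HasOrthogonality.integral_mul_C_mul, hφ.orthonormal k hk j hjN, if_neg (by omega)]
    · simp
    · exact (natDegree_le_of_degree_le hdeg.le).trans hjN
    · exact (natDegree_C_mul_le _ _).trans ((hφ.natDegree_eq j hjN).le.trans hjN)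

/-- Integrating the `k`-th orthonormal polynomial against a polynomial of degree at most `k`. -/
lemma integral_mul_of_natDegree_le (h : HasOrthogonality ρ N)
    (hφ : IsOrthonormalPolynomials ρ N φ) {k : ℕ} (hk : k ≤ N) {p : ℝ[X]}
    (hp : p.natDegree ≤ k) :
    ∫ x, (φ k).eval x * p.eval x ∂ρ = p.coeff k / (φ k).leadingCoeff := by
  have hdeg := degree_sub_C_mul_lt hp (hφ.natDegree_eq k hk) (hφ.ne_zero hk)
  have h0 := hφ.integral_mul_eq_zero_of_degree_lt h hk le_rfl hdeg
  set c := p.coeff k / (φ k).leadingCoeff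
  have hs : p = (p - C c * φ k) + C c * φ k := by ring
  have hkN : (φ k).natDegree ≤ N := by rw [hφ.natDegree_eq k hk]; exact hk
  rw [hs, h.integral_mul_add hkN ((natDegree_le_of_degree_le hdeg.le).trans hk)
    ((natDegree_C_mul_le _ _).trans hkN), h0, HasOrthogonality.integral_mul_C_mul,
    hφ.orthonormal k hk k hk, if_pos rfl]
  ring

/-- A polynomial of degree `k` with positive leading coefficient that is orthogonal to all
polynomials of smaller degree is a multiple of the `k`-th orthonormal polynomial. -/
lemma eq_sqrt_smul (h : HasOrthogonality ρ N) (hφ : IsOrthonormalPolynomials ρ N φ) {k : ℕ}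
    (hk : k ≤ N) {u : ℝ[X]} (hu : u.natDegree = k) (hlc : 0 < u.leadingCoeff)
    (horth : ∀ p : ℝ[X], p.degree < k → ∫ x, u.eval x * p.eval x ∂ρ = 0) :
    u = √(∫ x, u.eval x * u.eval x ∂ρ) • φ k := by
  have hφk := hφ.natDegree_eq k hk
  have hdeg := degree_sub_C_mul_lt hu.le hφk (hφ.ne_zero hk)
  have hcpos : 0 < u.coeff k / (φ k).leadingCoeff := by
    have : u.coeff k = u.leadingCoeff := by rw [leadingCoeff, hu]
    rw [this]
    exact div_pos hlc (hφ.leadingCoeff_pos k hk)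
  set c := u.coeff k / (φ k).leadingCoeff
  have hnd := (natDegree_le_of_degree_le hdeg.le).trans hk
  have hkN : (φ k).natDegree ≤ N := hφk.le.trans hk
  -- The difference has degree below `k`, so it is orthogonal to `u` and to `φ k`, hence to itself;
  -- `sq_pos` then forces it to vanish.
  have hkey : u = C c * φ k := by
    by_contra hne
    have hpos := h.sq_pos _ hnd (sub_ne_zero.2 hne)
    have h1 := horth _ hdeg
    have h2 := hφ.integral_mul_eq_zero_of_degree_lt h hk le_rfl hdeg
    have h3 : ∫ x, (u - C c * φ k).eval x * (u - C c * φ k).eval x ∂ρ =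
        ∫ x, u.eval x * (u - C c * φ k).eval x ∂ρ -
          c * ∫ x, (φ k).eval x * (u - C c * φ k).eval x ∂ρ := by
      rw [← integral_const_mul, ← integral_sub (h.integrable_mul (hu.le.trans hk) hnd)
        ((h.integrable_mul hkN hnd).const_mul c)]
      congr 1 with x
      simp only [eval_sub, eval_mul, eval_C]
      ring
    rw [h1, h2] at h3
    linarith
  have hint : ∫ x, u.eval x * u.eval x ∂ρ = c ^ 2 := by
    have h1 : ∀ x, u.eval x * u.eval x = c ^ 2 * ((φ k).eval x * (φ k).eval x) := by
      intro x
      rw [hkey, eval_mul, eval_C]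
      ring
    simp only [h1]
    rw [integral_const_mul, hφ.orthonormal k hk k hk, if_pos rfl, mul_one]
  rw [hint, Real.sqrt_sq hcpos.le, smul_eq_C_mul]
  exact hkey

end IsOrthonormalPolynomials

/-- The Gram–Schmidt construction of orthonormal polynomials. -/
lemma HasOrthogonality.exists_isOrthonormalPolynomials {ρ : Measure ℝ} {N : ℕ}
    (h : HasOrthogonality ρ N) : ∃ φ : ℕ → ℝ[X], IsOrthonormalPolynomials ρ N φ := by
  -- `K` counts the polynomials already constructed, so the last stage is `N + 1`.
  have step : ∀ K : ℕ, K ≤ N + 1 → ∃ φ : ℕ → ℝ[X],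
      (∀ k < K, (φ k).natDegree = k ∧ 0 < (φ k).leadingCoeff) ∧
      ∀ i < K, ∀ j < K, ∫ x, (φ i).eval x * (φ j).eval x ∂ρ = if i = j then 1 else 0 := by
    intro K
    induction K with
    | zero => exact fun _ => ⟨fun _ => 0, by simp, by simp⟩
    | succ K ih =>
      intro hK
      obtain ⟨φ, hφ1, hφ2⟩ := ih (by omega)
      set s : ℝ[X] := ∑ i ∈ Finset.range K, C (∫ x, (φ i).eval x * (X ^ K : ℝ[X]).eval x ∂ρ) * φ i
        with hs
      have hsdeg : s.degree < K := by
        rw [hs, degree_lt_iff_coeff_zero]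
        intro j hj
        rw [finsetSum_coeff]
        refine Finset.sum_eq_zero fun i hi => ?_
        have hiK := Finset.mem_range.1 hi
        rw [coeff_C_mul, coeff_eq_zero_of_natDegree_lt (by rw [(hφ1 i hiK).1]; omega), mul_zero]
      have hsX : s.degree < (X ^ K : ℝ[X]).degree := by rwa [degree_X_pow]
      set w : ℝ[X] := X ^ K - s with hw
      have hwdeg : w.natDegree = K := by
        rw [natDegree, hw, degree_sub_eq_left_of_degree_lt hsX, ← natDegree, natDegree_X_pow]
      have hwlc : w.leadingCoeff = 1 := by
        rw [hw, leadingCoeff_sub_of_degree_lt hsX, leadingCoeff_X_pow]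
      have hw0 : w ≠ 0 := leadingCoeff_ne_zero.1 (by rw [hwlc]; exact one_ne_zero)
      have horth : ∀ i < K, ∫ x, (φ i).eval x * w.eval x ∂ρ = 0 := by
        intro i hi
        have hiN : (φ i).natDegree ≤ N := by rw [(hφ1 i hi).1]; omega
        have h1 : ∀ x, (φ i).eval x * w.eval x = (φ i).eval x * (X ^ K : ℝ[X]).eval x -
            ∑ j ∈ Finset.range K, (∫ x, (φ j).eval x * (X ^ K : ℝ[X]).eval x ∂ρ) *
              ((φ i).eval x * (φ j).eval x) := by
          intro x
          rw [hw, eval_sub, mul_sub, hs, eval_finsetSum, Finset.mul_sum]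
          congr 1
          refine Finset.sum_congr rfl fun j _ => ?_
          rw [eval_mul, eval_C]
          ring
        have hint : ∀ j ∈ Finset.range K, Integrable (fun x =>
            (∫ x, (φ j).eval x * (X ^ K : ℝ[X]).eval x ∂ρ) *
              ((φ i).eval x * (φ j).eval x)) ρ := by
          intro j hj
          have hjK := Finset.mem_range.1 hj
          exact (h.integrable_mul hiN (by rw [(hφ1 j hjK).1]; omega)).const_mul _
        simp only [h1]
        rw [integral_sub (h.integrable_mul hiN (by rw [natDegree_X_pow]; omega))
          (integrable_finsetSum _ hint), integral_finsetSum _ hint]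
        simp only [integral_const_mul]
        rw [Finset.sum_eq_single i]
        · rw [hφ2 i hi i hi, if_pos rfl, mul_one, sub_self]
        · intro j hj hji
          rw [hφ2 i hi j (Finset.mem_range.1 hj), if_neg hji.symm, mul_zero]
        · intro hi'
          exact absurd (Finset.mem_range.2 hi) hi'
      have ht := h.sq_pos w (by omega) hw0
      set t := ∫ x, w.eval x * w.eval x ∂ρ with htdef
      have hr : 0 < (√t)⁻¹ := inv_pos.2 (Real.sqrt_pos.2 ht)
      have hupd : ∀ i < K, Function.update φ K (C (√t)⁻¹ * w) i = φ i :=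
        fun i hi => Function.update_of_ne hi.ne _ _
      have hupdK : Function.update φ K (C (√t)⁻¹ * w) K = C (√t)⁻¹ * w :=
        Function.update_self _ _ _
      have hcross : ∀ i < K, ∫ x, (φ i).eval x * (C (√t)⁻¹ * w).eval x ∂ρ = 0 := by
        intro i hi
        rw [HasOrthogonality.integral_mul_C_mul, horth i hi, mul_zero]
      refine ⟨Function.update φ K (C (√t)⁻¹ * w), ?_, ?_⟩
      · intro k hk
        rcases (Nat.lt_succ_iff.1 hk).lt_or_eq with hk | rfl
        · rw [hupd k hk]
          exact hφ1 k hk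
        · rw [hupdK, natDegree_C_mul hr.ne', leadingCoeff_mul, leadingCoeff_C, hwlc, mul_one]
          exact ⟨hwdeg, hr⟩
      · intro i hi j hj
        rcases (Nat.lt_succ_iff.1 hi).lt_or_eq with hi | rfl <;>
          rcases (Nat.lt_succ_iff.1 hj).lt_or_eq with hj | rfl
        · rw [hupd i hi, hupd j hj]
          exact hφ2 i hi j hj
        · rw [hupd i hi, hupdK, if_neg hi.ne, hcross i hi]
        · rw [hupd j hj, hupdK, if_neg hj.ne']
          simpa only [mul_comm] using hcross j hj
        · rw [hupdK, if_pos rfl, HasOrthogonality.integral_mul_C_mul]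
          have : ∀ x, (C (√t)⁻¹ * w).eval x * w.eval x = (√t)⁻¹ * (w.eval x * w.eval x) := by
            intro x
            rw [eval_mul, eval_C, mul_assoc]
          simp only [this]
          rw [integral_const_mul, ← htdef, ← mul_assoc, ← mul_inv, Real.mul_self_sqrt ht.le,
            inv_mul_cancel₀ ht.ne']
  obtain ⟨φ, h1, h2⟩ := step (N + 1) le_rfl
  exact ⟨φ, fun k hk => (h1 k (by omega)).1, fun k hk => (h1 k (by omega)).2,
    fun i hi j hj => h2 i (by omega) j (by omega)⟩

end IntegratedPearson

/-! ### Action of the derivatives of an orthonormal polynomial. -/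

namespace IntegratedPearson

open Filter

/-- Only `δ x²` times the top term of the derivative can reach this degree. -/
lemma coeff_quadPoly_mul_derivative (δ β γ : ℝ) {p : ℝ[X]} {d : ℕ} (hp : p.natDegree ≤ d) :
    (quadPoly δ β γ * derivative p).coeff (d + 1) = d * δ * p.coeff d := by
  have e : quadPoly δ β γ * derivative p = C δ * (X * (X * derivative p)) +
      C β * (X * derivative p) + C γ * derivative p := by
    simp only [quadPoly]
    ring
  have h1 : (X * derivative p).coeff d = d * p.coeff d := by
    rcases d with _ | d
    · simp
    · rw [coeff_X_mul, coeff_derivative]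
      push_cast
      ring
  have h2 : (derivative p).coeff d = 0 := by
    rw [coeff_derivative, coeff_eq_zero_of_natDegree_lt (by omega), zero_mul]
  have h3 : (derivative p).coeff (d + 1) = 0 := by
    rw [coeff_derivative, coeff_eq_zero_of_natDegree_lt (by omega), zero_mul]
  rw [e, coeff_add, coeff_add, coeff_C_mul, coeff_C_mul, coeff_C_mul, coeff_X_mul, coeff_X_mul,
    h1, h2, h3]
  ring

lemma natDegree_quadPoly_mul_derivative_le (δ β γ : ℝ) {p : ℝ[X]} {d : ℕ}
    (hp : p.natDegree ≤ d) : (quadPoly δ β γ * derivative p).natDegree ≤ d + 1 := by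
  rcases Nat.eq_zero_or_pos p.natDegree with h0 | h0
  · rw [derivative_of_natDegree_zero h0]
    simp
  · refine natDegree_mul_le.trans ?_
    have := natDegree_quadPoly_le δ β γ
    have := natDegree_derivative_le p
    omega

lemma natDegree_C_mul_X_sub_C_le (a b : ℝ) : (C a * X - C b : ℝ[X]).natDegree ≤ 1 := by
  have := natDegree_linear_le (a := a) (b := -b)
  rwa [C_neg, ← sub_eq_add_neg] at this

/-- If `φ` acts on polynomials of degree at most `K` as a multiple of the `K`-th coefficient, then
its `m`-th derivative does so for `K - m` with respect to the weight `q ^ m * f`. -/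
lemma IsPearsonDensity.polyExp_iterate_derivative {f : ℝ → ℝ} {μ δ β γ : ℝ} {N K : ℕ}
    (h : IsPearsonDensity f μ δ β γ) (hN : Integrable fun x => x ^ (2 * N) * f x) (hK : K ≤ N)
    {φ : ℝ[X]} (hφ : φ.natDegree ≤ K) {r : ℝ}
    (hr : ∀ p : ℝ[X], p.natDegree ≤ K → polyExp f (φ * p) = r * p.coeff K)
    {m d : ℕ} (hd : d + m = K) {p : ℝ[X]} (hp : p.natDegree ≤ d) :
    polyExp f (quadPoly δ β γ ^ m * (derivative^[m] φ * p)) =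
      r * (∏ l ∈ Finset.range m, (1 - ((K : ℝ) - 1 + l) * δ)) * p.coeff d := by
  induction m generalizing d p with
  | zero =>
    obtain rfl : d = K := by omega
    simpa using hr p hp
  | succ m ih =>
    set u := derivative^[m] φ with hu
    have hudeg : u.natDegree ≤ d + 1 := (natDegree_iterate_derivative φ m).trans (by omega)
    set L : ℝ[X] := C (1 - 2 * m * δ) * X - C (μ + m * β) with hL
    have hLp : (L * p).natDegree ≤ d + 1 := by
      refine natDegree_mul_le.trans ?_
      have := natDegree_C_mul_X_sub_C_le (1 - 2 * m * δ) (μ + m * β)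
      rw [← hL] at this
      omega
    have hQp := natDegree_quadPoly_mul_derivative_le δ β γ hp
    have hQm := natDegree_quadPoly_pow_le δ β γ m
    have hbound : ∀ w : ℝ[X], w.natDegree ≤ d + 1 →
        (quadPoly δ β γ ^ m * (u * w)).natDegree ≤ 2 * N := by
      intro w hw
      have h1 := natDegree_mul_le (p := quadPoly δ β γ ^ m) (q := u * w)
      have h2 := natDegree_mul_le (p := u) (q := w)
      omega
    -- This bound is just enough: the next identity needs `2m + (2d + 1) + 1 = 2K ≤ 2N`.
    have hup : (u * p).natDegree ≤ d + 1 + d := natDegree_mul_le.trans (by omega)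
    have key := h.polyExp_quadPoly_pow_mul hN (g := u * p) (m := m) (by omega)
    have e1 : quadPoly δ β γ ^ (m + 1) * derivative (u * p) =
        quadPoly δ β γ ^ (m + 1) * (derivative^[m + 1] φ * p) +
          quadPoly δ β γ ^ m * (u * (quadPoly δ β γ * derivative p)) := by
      rw [derivative_mul, Function.iterate_succ_apply']
      ring
    have e2 : quadPoly δ β γ ^ m * (L * (u * p)) = quadPoly δ β γ ^ m * (u * (L * p)) := by ring
    have hdeg3 : (quadPoly δ β γ ^ (m + 1) * (derivative^[m + 1] φ * p)).natDegree ≤ 2 * N := by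
      have h1 := natDegree_mul_le (p := quadPoly δ β γ ^ (m + 1)) (q := derivative^[m + 1] φ * p)
      have h2 := natDegree_mul_le (p := derivative^[m + 1] φ) (q := p)
      have h3 := natDegree_quadPoly_pow_le δ β γ (m + 1)
      have h4 := natDegree_iterate_derivative φ (m + 1)
      omega
    rw [← hL, e1, e2, h.polyExp_add hN hdeg3 (hbound _ hQp),
      ih (by omega) hLp, ih (by omega) hQp, coeff_quadPoly_mul_derivative δ β γ hp] at key
    have hcoeff : (L * p).coeff (d + 1) = (1 - 2 * m * δ) * p.coeff d := by
      rw [hL, sub_mul, mul_assoc, coeff_sub, coeff_C_mul, coeff_C_mul, coeff_X_mul,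
        coeff_eq_zero_of_natDegree_lt (n := d + 1) (by omega)]
      ring
    rw [hcoeff] at key
    have hKd : (K : ℝ) = d + (m + 1) := by rw [← hd]; push_cast; ring
    rw [Finset.prod_range_succ]
    -- The new factor is the top coefficient `1 - 2mδ` from `L p` minus `dδ` from `q p'`.
    have e3 : 1 - ((K : ℝ) - 1 + m) * δ = 1 - 2 * m * δ - d * δ := by rw [hKd]; ring
    rw [e3]
    linarith

/-! ### Transfer to the law of `X` and to the weighted laws. -/

section Law

variable {Ω : Type*} [MeasurableSpace Ω] {P : Measure Ω} {X : Ω → ℝ} {f : ℝ → ℝ} {μ δ β γ : ℝ}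

lemma IsIP.integrable_comp_iff (hX : IsIP P X f μ δ β γ) {g : ℝ → ℝ} (hg : Continuous g) :
    Integrable (fun w => g (X w)) P ↔ Integrable fun x => g x * f x := by
  have h1 := integrable_map_measure (μ := P) (f := X) (g := g) hg.aestronglyMeasurable
    hX.aemeasurable
  rw [show (fun w => g (X w)) = g ∘ X from rfl, ← h1, hX.law_eq,
    integrable_withDensity_iff_integrable_smul' hX.measurable_density.ennreal_ofReal
      (Eventually.of_forall fun x => ENNReal.ofReal_lt_top)]
  refine integrable_congr (Eventually.of_forall fun x => ?_)
  simp only [ENNReal.toReal_ofReal (hX.density_nonneg x), smul_eq_mul, mul_comm]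

lemma IsIP.integral_comp (hX : IsIP P X f μ δ β γ) {g : ℝ → ℝ} (hg : Continuous g) :
    ∫ w, g (X w) ∂P = ∫ x, g x * f x := by
  rw [← integral_map hX.aemeasurable hg.aestronglyMeasurable, hX.law_eq,
    integral_withDensity_eq_integral_toReal_smul hX.measurable_density.ennreal_ofReal
      (Eventually.of_forall fun x => ENNReal.ofReal_lt_top)]
  congr 1 with x
  simp only [ENNReal.toReal_ofReal (hX.density_nonneg x), smul_eq_mul, mul_comm]

lemma IsIP.isPearsonDensity [IsProbabilityMeasure P] (hX : IsIP P X f μ δ β γ) :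
    IsPearsonDensity f μ δ β γ where
  measurable := hX.measurable_density
  nonneg := hX.density_nonneg
  integrable := by
    simpa using (hX.integrable_comp_iff (g := fun _ => 1) continuous_const).1
      (integrable_const 1)
  integral_eq_one := by
    simpa using (hX.integral_comp (g := fun _ => 1) continuous_const).symm
  integrable_mul := (hX.integrable_comp_iff continuous_id).1 hX.integrable
  mean_eq := (hX.integral_comp continuous_id).symm.trans hX.mean_eq
  quad_ne_zero := hX.quad_ne_zero
  identity := hX.identity

lemma continuous_quad (δ β γ : ℝ) : Continuous (quad δ β γ) := by
  unfold quad
  fun_prop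

lemma IsIP.expQuadPow_eq (hX : IsIP P X f μ δ β γ) (m : ℕ) :
    expQuadPow P X δ β γ m = polyExp f (quadPoly δ β γ ^ m) := by
  rw [expQuadPow, hX.integral_comp (g := fun x => quad δ β γ x ^ m)
    ((continuous_quad δ β γ).pow m)]
  simp [polyExp]

lemma IsIP.map_eq_weightedLaw_zero [IsProbabilityMeasure P] (hX : IsIP P X f μ δ β γ) :
    P.map X = weightedLaw P X f δ β γ 0 := by
  simp [hX.law_eq, weightedLaw, expQuadPow]

lemma IsIP.measurable_weighted (hX : IsIP P X f μ δ β γ) (m : ℕ) :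
    Measurable fun x => quad δ β γ x ^ m * f x / expQuadPow P X δ β γ m :=
  ((((continuous_quad δ β γ).measurable.pow_const m).mul hX.measurable_density).div_const _)

lemma IsIP.integral_map_eval (hX : IsIP P X f μ δ β γ) (p : ℝ[X]) :
    ∫ x, p.eval x ∂(P.map X) = polyExp f p := by
  rw [integral_map hX.aemeasurable p.continuous.aestronglyMeasurable,
    hX.integral_comp p.continuous, polyExp]

lemma IsIP.integrable_abs_pow_iff (hX : IsIP P X f μ δ β γ) (n : ℕ) :
    Integrable (fun w => |X w| ^ (2 * n)) P ↔ Integrable fun x => x ^ (2 * n) * f x := by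
  rw [hX.integrable_comp_iff (g := fun x => |x| ^ (2 * n)) (by fun_prop)]
  simp only [(even_two_mul n).pow_abs]

variable [IsProbabilityMeasure P] {N m : ℕ}

/-- Guarantees that `ENNReal.ofReal` in `weightedLaw` truncates nothing, up to a null set. -/
lemma IsIP.ae_density_nonneg (hX : IsIP P X f μ δ β γ)
    (hN : Integrable fun x => x ^ (2 * N) * f x) (hm : m ≤ N) :
    ∀ᵐ x, 0 ≤ quad δ β γ x ^ m * f x / expQuadPow P X δ β γ m := by
  have h := hX.isPearsonDensity
  have hE := h.polyExp_quadPoly_pow_pos hN hm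
  rw [← hX.expQuadPow_eq] at hE
  filter_upwards [h.ae_quad_pos] with x hx
  refine div_nonneg ?_ hE.le
  by_cases hf : f x = 0
  · simp [hf]
  · exact mul_nonneg (pow_nonneg (hx hf).le m) (h.nonneg x)

lemma IsIP.integrable_weightedLaw (hX : IsIP P X f μ δ β γ)
    (hN : Integrable fun x => x ^ (2 * N) * f x) (hm : m ≤ N) {p : ℝ[X]}
    (hp : p.natDegree ≤ 2 * (N - m)) :
    Integrable (fun x => p.eval x) (weightedLaw P X f δ β γ m) := by
  have h := hX.isPearsonDensity
  rw [weightedLaw, integrable_withDensity_iff_integrable_smul'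
    (hX.measurable_weighted m).ennreal_ofReal (Eventually.of_forall fun x => ENNReal.ofReal_lt_top)]
  have hdeg : (quadPoly δ β γ ^ m * p).natDegree ≤ 2 * N := by
    have := natDegree_quadPoly_pow_le δ β γ m
    exact natDegree_mul_le.trans (by omega)
  refine ((h.integrable_eval_mul hN hdeg).div_const (expQuadPow P X δ β γ m)).congr ?_
  filter_upwards [hX.ae_density_nonneg hN hm] with x hx
  rw [ENNReal.toReal_ofReal hx, eval_mul, eval_pow, eval_quadPoly, smul_eq_mul]
  ring

lemma IsIP.integral_weightedLaw (hX : IsIP P X f μ δ β γ)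
    (hN : Integrable fun x => x ^ (2 * N) * f x) (hm : m ≤ N) (p : ℝ[X]) :
    ∫ x, p.eval x ∂(weightedLaw P X f δ β γ m) =
      polyExp f (quadPoly δ β γ ^ m * p) / expQuadPow P X δ β γ m := by
  rw [weightedLaw, integral_withDensity_eq_integral_toReal_smul
    (hX.measurable_weighted m).ennreal_ofReal (Eventually.of_forall fun x => ENNReal.ofReal_lt_top),
    polyExp, ← integral_div]
  refine integral_congr_ae ?_
  filter_upwards [hX.ae_density_nonneg hN hm] with x hx
  rw [ENNReal.toReal_ofReal hx, eval_mul, eval_pow, eval_quadPoly, smul_eq_mul]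
  ring

lemma IsIP.isProbabilityMeasure_weightedLaw (hX : IsIP P X f μ δ β γ)
    (hN : Integrable fun x => x ^ (2 * N) * f x) (hm : m ≤ N) :
    IsProbabilityMeasure (weightedLaw P X f δ β γ m) := by
  have h := hX.isPearsonDensity
  have hE := h.polyExp_quadPoly_pow_pos hN hm
  rw [← hX.expQuadPow_eq] at hE
  have hint : Integrable fun x => quad δ β γ x ^ m * f x / expQuadPow P X δ β γ m := by
    have := h.integrable_eval_mul hN (p := quadPoly δ β γ ^ m)
      ((natDegree_quadPoly_pow_le _ _ _ _).trans (by omega))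
    simpa only [eval_pow, eval_quadPoly] using this.div_const (expQuadPow P X δ β γ m)
  refine ⟨?_⟩
  rw [weightedLaw, withDensity_apply _ MeasurableSet.univ, Measure.restrict_univ,
    ← ofReal_integral_eq_lintegral_ofReal hint (hX.ae_density_nonneg hN hm), integral_div]
  have : ∫ x, quad δ β γ x ^ m * f x = expQuadPow P X δ β γ m := by
    rw [hX.expQuadPow_eq, polyExp]
    simp
  rw [this, div_self hE.ne', ENNReal.ofReal_one]

lemma IsIP.hasOrthogonality_weightedLaw (hX : IsIP P X f μ δ β γ)
    (hN : Integrable fun x => x ^ (2 * N) * f x) (hm : m ≤ N) :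
    HasOrthogonality (weightedLaw P X f δ β γ m) (N - m) where
  integrable p hp := hX.integrable_weightedLaw hN hm hp
  sq_pos p hp hp0 := by
    have h := hX.isPearsonDensity
    have hE := h.polyExp_quadPoly_pow_pos hN hm
    rw [← hX.expQuadPow_eq] at hE
    have e := hX.integral_weightedLaw hN hm (p * p)
    simp only [eval_mul] at e
    rw [e]
    refine div_pos (h.polyExp_pos hN ?_ (mul_ne_zero (pow_ne_zero _ h.quadPoly_ne_zero)
      (mul_ne_zero hp0 hp0)) ?_) hE
    · have h1 := natDegree_quadPoly_pow_le δ β γ m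
      have h2 := natDegree_mul_le (p := p) (q := p)
      exact natDegree_mul_le.trans (by omega)
    · filter_upwards [h.ae_quad_pos] with x hx hf
      simp only [eval_mul, eval_pow, eval_quadPoly]
      exact mul_nonneg (pow_nonneg (hx hf).le m) (mul_self_nonneg _)

lemma IsIP.hasOrthogonality_map (hX : IsIP P X f μ δ β γ)
    (hN : Integrable fun x => x ^ (2 * N) * f x) : HasOrthogonality (P.map X) N := by
  rw [hX.map_eq_weightedLaw_zero]
  simpa using hX.hasOrthogonality_weightedLaw hN (Nat.zero_le N)

lemma prod_Icc_int_eq_prod_range (g : ℤ → ℝ) (a : ℤ) (m : ℕ) :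
    ∏ j ∈ Finset.Icc a (a + m - 1), g j = ∏ l ∈ Finset.range m, g (a + l) := by
  refine (Finset.prod_nbij' (fun l : ℕ => a + (l : ℤ)) (fun j : ℤ => (j - a).toNat)
    ?_ ?_ ?_ ?_ ?_).symm
  · intro l hl
    rw [Finset.mem_range] at hl
    rw [Finset.mem_Icc]
    omega
  · intro j hj
    rw [Finset.mem_Icc] at hj
    rw [Finset.mem_range]
    omega
  · intro l _
    simp
  · intro j hj
    rw [Finset.mem_Icc] at hj
    omega
  · intro l _
    rfl

lemma nu_eq (P : Measure Ω) (X : Ω → ℝ) (δ β γ : ℝ) (k m : ℕ) :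
    nu P X δ β γ k m = √(((k + m).descFactorial m : ℝ) *
      (∏ l ∈ Finset.range m, (1 - (((k + m : ℕ) : ℝ) - 1 + l) * δ)) /
        expQuadPow P X δ β γ m) := by
  have h1 : ((k + m).factorial : ℝ) / (k.factorial : ℝ) = ((k + m).descFactorial m : ℝ) := by
    have := Nat.factorial_mul_descFactorial (n := k + m) (k := m) (by omega)
    rw [Nat.add_sub_cancel] at this
    rw [div_eq_iff (by positivity), ← this]
    push_cast
    ring
  -- Exhibits the index range as `m` consecutive integers; for `k = m = 0` it starts at `-1` and is
  -- empty.
  have h2 : (k : ℤ) + 2 * m - 2 = (k + m - 1 : ℤ) + m - 1 := by ring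
  rw [nu, h1, h2, prod_Icc_int_eq_prod_range (fun j : ℤ => 1 - (j : ℝ) * δ)]
  push_cast
  rfl

/-- The derivatives of the orthonormal polynomials are multiples of the orthonormal polynomials of
the weighted law. -/
lemma IsIP.iterate_derivative_eq (hX : IsIP P X f μ δ β γ)
    (hN : Integrable fun x => x ^ (2 * N) * f x) (hm : m ≤ N) {φ ψ : ℕ → ℝ[X]}
    (hφ : IsOrthonormalPolynomials (P.map X) N φ)
    (hψ : IsOrthonormalPolynomials (weightedLaw P X f δ β γ m) (N - m) ψ) {k : ℕ}
    (hk : k ≤ N - m) :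
    0 < nu P X δ β γ k m ∧ derivative^[m] (φ (k + m)) = nu P X δ β γ k m • ψ k := by
  have h := hX.isPearsonDensity
  have hE := h.polyExp_quadPoly_pow_pos hN hm
  rw [← hX.expQuadPow_eq] at hE
  have hkm : k + m ≤ N := by omega
  have hdeg := hφ.natDegree_eq _ hkm
  have hlc := hφ.leadingCoeff_pos _ hkm
  have hcoeff : (φ (k + m)).coeff (k + m) = (φ (k + m)).leadingCoeff := by
    rw [leadingCoeff, hdeg]
  set r := ((φ (k + m)).leadingCoeff)⁻¹ with hr
  have hact : ∀ p : ℝ[X], p.natDegree ≤ k + m →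
      polyExp f (φ (k + m) * p) = r * p.coeff (k + m) := by
    intro p hp
    have := hφ.integral_mul_of_natDegree_le (hX.hasOrthogonality_map hN) hkm hp
    rw [← hX.integral_map_eval]
    simp only [eval_mul]
    rw [this, hr]
    ring
  set u := derivative^[m] (φ (k + m)) with hu
  have hucoeff : u.coeff k = (k + m).descFactorial m * (φ (k + m)).leadingCoeff := by
    rw [hu, coeff_iterate_derivative, hcoeff, nsmul_eq_mul]
  have hucpos : 0 < u.coeff k := by
    rw [hucoeff]
    have : 0 < (k + m).descFactorial m := Nat.descFactorial_pos.2 (by omega)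
    positivity
  have hule : u.natDegree ≤ k := (natDegree_iterate_derivative _ m).trans (by omega)
  have hudeg : u.natDegree = k := le_antisymm hule (le_natDegree_of_ne_zero hucpos.ne')
  have hulc : 0 < u.leadingCoeff := by rwa [leadingCoeff, hudeg]
  -- This one formula gives both the orthogonality of `u` to lower degrees and, with `p = u`, its
  -- squared norm, where `r` cancels the leading coefficient.
  have hW : ∀ p : ℝ[X], p.natDegree ≤ k →
      ∫ x, u.eval x * p.eval x ∂(weightedLaw P X f δ β γ m) =
        r * (∏ l ∈ Finset.range m, (1 - (((k + m : ℕ) : ℝ) - 1 + l) * δ)) * p.coeff k /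
          expQuadPow P X δ β γ m := by
    intro p hp
    rw [← h.polyExp_iterate_derivative hN hkm hdeg.le hact rfl hp,
      ← hX.integral_weightedLaw hN hm]
    simp only [eval_mul, hu]
  have hsq : ∫ x, u.eval x * u.eval x ∂(weightedLaw P X f δ β γ m) =
      ((k + m).descFactorial m : ℝ) *
      (∏ l ∈ Finset.range m, (1 - (((k + m : ℕ) : ℝ) - 1 + l) * δ)) /
        expQuadPow P X δ β γ m := by
    have hne := hlc.ne'
    rw [hW u hule, hucoeff, hr]
    set w := ∏ l ∈ Finset.range m, (1 - (((k + m : ℕ) : ℝ) - 1 + l) * δ)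
    field_simp
  have hort := hX.hasOrthogonality_weightedLaw hN hm
  have hfin := hψ.eq_sqrt_smul hort hk hudeg hulc fun p hp => by
    rw [hW p (natDegree_le_of_degree_le hp.le), (degree_lt_iff_coeff_zero _ _).1 hp k le_rfl]
    simp
  -- The radicand is positive because it is a squared norm; the signs of the factors `1 - jδ` need
  -- no discussion.
  have hpos := hort.sq_pos u (hule.trans hk) (leadingCoeff_ne_zero.1 hulc.ne')
  rw [hsq] at hfin hpos
  rw [nu_eq]
  exact ⟨Real.sqrt_pos.2 hpos, hfin⟩

/-- The covariance identity with `g = x - μ`. -/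
lemma IsIP.variance_eq (hX : IsIP P X f μ δ β γ) (hN : Integrable fun x => x ^ (2 * N) * f x)
    (h1 : 1 ≤ N) : variance X P = expQuadPow P X δ β γ 1 := by
  have h := hX.isPearsonDensity
  have hs := h.polyExp_sub_mean_mul hN (g := Polynomial.X - C μ)
    (by rw [natDegree_X_sub_C]; omega)
  rw [derivative_X_sub_C, mul_one] at hs
  rw [variance_eq_integral hX.aemeasurable, hX.mean_eq, hX.expQuadPow_eq, pow_one, ← hs,
    hX.integral_comp (g := fun x => (x - μ) ^ 2) (by fun_prop), polyExp]
  simp [sq]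

lemma nu_one (P : Measure Ω) (X : Ω → ℝ) (δ β γ : ℝ) (k : ℕ) :
    nu P X δ β γ k 1 = √(((k : ℝ) + 1) * (1 - k * δ) / expQuadPow P X δ β γ 1) := by
  rw [nu_eq]
  simp

end Law

end IntegratedPearson

/-! ### The main theorem. -/

open IntegratedPearson in
theorem mainTheorem1 {Ω : Type*} [MeasurableSpace Ω] (P : Measure Ω) [IsProbabilityMeasure P]
    (X : Ω → ℝ) (f : ℝ → ℝ) (μ δ β γ : ℝ) (hX : IsIP P X f μ δ β γ) (n : ℕ) (hn : 1 ≤ n) :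
    -- the moment condition in terms of `δ`
    (Integrable (fun w => |X w| ^ (2 * n)) P ↔ δ < 1 / (2 * (n : ℝ) - 1)) ∧
    (Integrable (fun w => |X w| ^ (2 * n)) P →
      -- the orthonormal polynomials of `X` exist
      (∃ φ : ℕ → ℝ[X], IsOrthonormalPolynomials (P.map X) n φ) ∧
      -- general order `m` of differentiation
      (∀ m ≤ n,
        Integrable (fun w => quad δ β γ (X w) ^ m) P ∧
        0 < expQuadPow P X δ β γ m ∧
        expQuadPow P X δ β γ m = A μ δ β γ m ∧
        IsProbabilityMeasure (weightedLaw P X f δ β γ m) ∧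
        (∃ ψ : ℕ → ℝ[X],
          IsOrthonormalPolynomials (weightedLaw P X f δ β γ m) (n - m) ψ) ∧
        ∀ φ ψ : ℕ → ℝ[X],
          IsOrthonormalPolynomials (P.map X) n φ →
          IsOrthonormalPolynomials (weightedLaw P X f δ β γ m) (n - m) ψ →
          ∀ k ≤ n - m,
            0 < nu P X δ β γ k m ∧
            derivative^[m] (φ (k + m)) = nu P X δ β γ k m • ψ k) ∧
      -- the case `m = 1`
      (∀ φ ψ : ℕ → ℝ[X],
        IsOrthonormalPolynomials (P.map X) n φ →
        IsOrthonormalPolynomials (weightedLaw P X f δ β γ 1) (n - 1) ψ →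
        ∀ k ≤ n - 1,
          derivative (φ (k + 1)) =
            (√(((k : ℝ) + 1) * (1 - (k : ℝ) * δ)) / √(variance X P)) • ψ k ∧
          derivative (φ (k + 1)) =
            √(((k : ℝ) + 1) * (1 - δ) * (1 - (k : ℝ) * δ) / quad δ β γ μ) • ψ k)) := by
  have h := hX.isPearsonDensity
  have hn1 : (1 : ℝ) ≤ n := by exact_mod_cast hn
  refine ⟨?_, fun hmom => ?_⟩
  · rw [hX.integrable_abs_pow_iff, lt_div_iff₀ (by linarith), mul_comm δ]
    refine ⟨fun hN => ?_, h.integrable_pow_mul n⟩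
    -- At `m = n - 1` the positive factor `1 - (2m+1)δ` is `1 - (2n-1)δ`.
    have hpos := (h.polyExp_quadPoly_pow_succ hN (m := n - 1) (by omega)).2.1
    rw [Nat.cast_sub hn, Nat.cast_one] at hpos
    linarith
  · have hN := (hX.integrable_abs_pow_iff n).1 hmom
    refine ⟨(hX.hasOrthogonality_map hN).exists_isOrthonormalPolynomials, fun m hm => ?_, ?_⟩
    · refine ⟨?_, ?_, ?_, hX.isProbabilityMeasure_weightedLaw hN hm,
        (hX.hasOrthogonality_weightedLaw hN hm).exists_isOrthonormalPolynomials,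
        fun φ ψ hφ hψ k hk => hX.iterate_derivative_eq hN hm hφ hψ hk⟩
      · rw [hX.integrable_comp_iff (g := fun x => quad δ β γ x ^ m)
          ((continuous_quad δ β γ).pow m)]
        have := h.integrable_eval_mul hN (p := quadPoly δ β γ ^ m)
          ((natDegree_quadPoly_pow_le _ _ _ _).trans (by omega))
        simpa only [eval_pow, eval_quadPoly] using this
      · rw [hX.expQuadPow_eq]
        exact h.polyExp_quadPoly_pow_pos hN hm
      · rw [hX.expQuadPow_eq]
        exact h.polyExp_quadPoly_pow_eq hN hm
    · intro φ ψ hφ hψ k hk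
      obtain ⟨_, hd⟩ := hX.iterate_derivative_eq hN hn hφ hψ hk
      rw [Function.iterate_one, nu_one] at hd
      have hE := h.polyExp_quadPoly_pow_pos hN hn
      rw [← hX.expQuadPow_eq] at hE
      refine ⟨?_, ?_⟩
      · rw [hX.variance_eq hN hn, ← Real.sqrt_div' _ hE.le]
        exact hd
      · obtain ⟨_, h2, h3, h4⟩ := h.polyExp_quadPoly_pow_succ hN (m := 0) hn
        rw [← hX.expQuadPow_eq, ← hX.expQuadPow_eq] at h4
        have h0 : expQuadPow P X δ β γ 0 = 1 := by simp [expQuadPow]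
        simp only [h0, Nat.cast_zero, mul_zero, zero_mul, zero_add, add_zero, sub_zero, one_mul,
          mul_one, div_one] at h2 h3 h4
        rw [hd, ← h4]
        congr 2
        field_simp
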